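/- Let $p$ and $q$ be primes with $p\equiv 1\pmod 8$ and $q\equiv 7\pmod 8$. Suppose $p=c^2+d^2=x^2+2qy^2$ with $c,d,x,y\in\mathbb Z$, where $c\equiv 1\pmod 4$ and $d=2^r d_0$ with $r\ge 0$ and $d_0$ integers and $d_0\equiv 1\pmod 4$. Assume that $\gcd(c,x+d)=1$ or $\gcd(d_0,x+c)=1$. Then for every integer $m$, $$(-q)^{(p-1)/8}\equiv \left(\frac dc\right)^m \pmod p\quad\Longleftrightarrow\quad \left(\frac{c-di}{c+di}\right)^{(q+1)/8}\equiv i^m \pmod q .$$ Here $i=\sqrt{-1}$ and $\frac dc$ denotes the quotient of residue classes modulo $p$. For $z,w\in\mathbb Q(i)$, $z\equiv w\pmod q$ means that $z-w=q\,\frac st$ for some $s,t\in\mathbb Z[i]$ with $t$ relatively prime to $q$ in $\mathbb Z[i]$. -/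

import Mathlib

/-- Congruence modulo `n` between Gaussian fractions (elements of `ℚ(i) ⊆ ℂ`):
`z ≡ w (mod n)` means that `z - w = n * (s / t)` for Gaussian integers `s` and `t`
with `t` relatively prime to `n`. -/
def GaussModEq (n : ℕ) (z w : ℂ) : Prop :=
  ∃ s t : GaussianInt, IsCoprime t (n : GaussianInt) ∧
    z - w = (n : ℂ) * (GaussianInt.toComplex s / GaussianInt.toComplex t)

/-!
Let `χ` be the octic residue character modulo `p`, with values in `ℤ[ζ₈]`, and read its Gauss sum
`G` in characteristic `q`. As `q ≡ 7 (mod 8)`, Frobenius gives `G ^ (q + 1) = χ(-q) p`. On the other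
hand `G ^ 8 = p ρ ^ 4 π ^ 2`, where `π = c + d i` and `ρ = A + B √-2` are factors of `p` coming from
the Jacobi sums of `χ ^ 2` and `χ` with the quadratic character. The theorem amounts to
`χ(-q) = (π' / π) ^ ((q + 1) / 8)` with `π' = c - d i`, that is, since `p = π π'`, to
`(ρ π) ^ ((q + 1) / 2) = p`.

In characteristic `q` both `π` and `ρ` have norm `p = x ^ 2`, so each half power is `± x`, the sign
being a Legendre symbol: `π` is a constant times the square of `(x + d) - c i`, and `ρ` of
`(x + A) + B √-2`. The factorizations of `(x + d) (x - d)` and `(x + A) (x - A)` as binary quadratic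
forms turn these symbols into `χ₈(x + d)` and `χ₄((x + A) / 2)`, which agree because
`c ^ 2 + d ^ 2 = A ^ 2 + 2 B ^ 2`.
-/

open Polynomial
open scoped NumberTheorySymbols

section NormForms

theorem isCoprime_of_prime_eq_sq_add_mul_sq {P a b k : ℤ} (hP : Prime P)
    (h : P = a ^ 2 + k * b ^ 2) : IsCoprime a b := by
  refine isCoprime_of_prime_dvd (fun h0 => hP.ne_zero (by simp [h, h0.1, h0.2])) ?_
  rintro l hl ⟨a, rfl⟩ ⟨b, rfl⟩
  have h' : P = l * (l * (a ^ 2 + k * b ^ 2)) := by rw [h]; ring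
  exact (hP.irreducible.isUnit_or_isUnit h').elim hl.not_isUnit
    fun hu => hl.not_isUnit (isUnit_of_mul_isUnit_left hu)

theorem not_dvd_of_mul_add_eq_two_mul {l m n k x w : ℤ} (hl : Prime l) (hn : Odd n)
    (hadd : m * n + k = 2 * x) (hxw : IsCoprime x w) (hln : l ∣ n) (hlk : l ∣ k) : ¬ l ∣ w := by
  intro hlw
  rcases hl.dvd_or_dvd (hadd ▸ dvd_add (hln.mul_left m) hlk) with h2 | hlx
  · exact hl.not_isUnit ((Int.isCoprime_two_left.mpr hn).isUnit_of_dvd' h2 hln)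
  · exact hl.not_isUnit (hxw.isUnit_of_dvd' hlx hlw)

-- Descent: a prime `l ∣ n` with `(D / l) = -1` divides `u` and `w`, hence `l² ∣ n`.
theorem jacobiSym_ne_neg_one_of_mul_eq_sq_sub {D : ℤ} {n : ℕ} {k u w : ℤ}
    (h : n * k = u ^ 2 - D * w ^ 2) (hprim : ∀ l : ℤ, Prime l → l ∣ n → l ∣ k → ¬ l ∣ w) :
    J(D | n) ≠ -1 := by
  induction n using Nat.strong_induction_on generalizing u w with
  | _ n ih =>
  intro hJ
  obtain ⟨l, hl, hln, hJl⟩ := jacobiSym.eq_neg_one_at_prime_divisor_of_eq_neg_one hJ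
  have : Fact l.Prime := ⟨hl⟩
  have hlp : Prime (l : ℤ) := Nat.prime_iff_prime_int.mp hl
  obtain ⟨⟨u', rfl⟩, ⟨w', rfl⟩⟩ := jacobiSym.prime_dvd_of_eq_neg_one hJl
    (h ▸ (Int.natCast_dvd_natCast.mpr hln).mul_right k)
  have hlk : ¬ (l : ℤ) ∣ k := fun hlk =>
    hprim l hlp (Int.natCast_dvd_natCast.mpr hln) hlk (dvd_mul_right _ _)
  obtain ⟨n, rfl⟩ := hln
  have h' : (n : ℤ) * k = l * (u' ^ 2 - D * w' ^ 2) := by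
    refine mul_left_cancel₀ hlp.ne_zero ?_
    push_cast at h
    linear_combination h
  obtain ⟨n, rfl⟩ : l ∣ n :=
    Int.natCast_dvd_natCast.mp ((hlp.dvd_or_dvd (Dvd.intro _ h'.symm)).resolve_right hlk)
  have h'' : (n : ℤ) * k = u' ^ 2 - D * w' ^ 2 := by
    refine mul_left_cancel₀ hlp.ne_zero ?_
    push_cast at h'
    linear_combination h'
  have hn : n ≠ 0 := by
    rintro rfl
    simp at hJ
  have : NeZero l := ⟨hl.ne_zero⟩
  have : NeZero n := ⟨hn⟩
  refine ih n ?_ h'' (fun r hr hrn hrk hrw => hprim r hr ?_ hrk (hrw.mul_left _)) ?_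
  · rw [← mul_assoc]
    exact lt_mul_of_one_lt_left (Nat.pos_of_ne_zero hn) (Nat.one_lt_mul_iff.mpr
      ⟨hl.pos, hl.pos, .inl hl.one_lt⟩)
  · push_cast
    exact (hrn.mul_left _).mul_left _
  · rwa [jacobiSym.mul_right, jacobiSym.mul_right, hJl, neg_one_mul, neg_one_mul, neg_neg] at hJ

theorem jacobiSym_natAbs_eq_one_of_mul_eq_sq_sub {D n k u w : ℤ} (hD : IsCoprime D n)
    (h : n * k = u ^ 2 - D * w ^ 2) (hprim : ∀ l : ℤ, Prime l → l ∣ n → l ∣ k → ¬ l ∣ w) :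
    J(D | n.natAbs) = 1 := by
  have hgcd : D.gcd n.natAbs = 1 :=
    (Int.isCoprime_iff_gcd_eq_one.mp hD : D.gcd n = 1)
  refine (jacobiSym.eq_one_or_neg_one hgcd).resolve_right ?_
  rcases Int.natAbs_eq n with hn | hn
  · refine jacobiSym_ne_neg_one_of_mul_eq_sq_sub (hn ▸ h) fun l hl hln => hprim l hl ?_
    exact Int.dvd_natAbs.mp hln
  · refine jacobiSym_ne_neg_one_of_mul_eq_sq_sub (k := -k) (u := u) (w := w) ?_
      fun l hl hln hlk => hprim l hl (Int.dvd_natAbs.mp hln) (dvd_neg.mp hlk)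
    linear_combination h - k * hn

theorem legendreSym_eq_χ₄_mul_jacobiSym {q : ℕ} [Fact q.Prime] (hq : q % 4 = 3) {n : ℤ}
    (hn : Odd n) : legendreSym q n = ZMod.χ₄ n * J(q | n.natAbs) := by
  have hq_odd : Odd q := Nat.odd_iff.mpr (by omega)
  have hn_odd : Odd n.natAbs := Int.natAbs_odd.mpr hn
  have hrec : J(n.natAbs | q) = ZMod.χ₄ n.natAbs * J(q | n.natAbs) := by
    rcases Nat.odd_mod_four_iff.mp (Nat.odd_iff.mp hn_odd) with h | h
    · rw [ZMod.χ₄_nat_one_mod_four h, one_mul,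
        jacobiSym.quadratic_reciprocity_one_mod_four h hq_odd]
    · rw [ZMod.χ₄_nat_three_mod_four h, neg_one_mul,
        jacobiSym.quadratic_reciprocity_three_mod_four h hq]
  rw [jacobiSym.legendreSym.to_jacobiSym]
  obtain ⟨N, rfl | rfl⟩ := n.eq_nat_or_neg
  · simpa using hrec
  · have hχ : ZMod.χ₄ (-N) = -ZMod.χ₄ N := by
      rw [← neg_one_mul, map_mul, (by decide : ZMod.χ₄ (-1) = -1), neg_one_mul]
    simp only [Int.natAbs_neg, Int.natAbs_natCast] at hrec ⊢
    rw [jacobiSym.neg _ hq_odd, ZMod.χ₄_nat_three_mod_four hq, hrec, Int.cast_neg,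
      Int.cast_natCast, hχ, neg_one_mul, neg_mul]

theorem jacobiSym_two_natAbs {n : ℤ} (hn : Odd n) : J(2 | n.natAbs) = ZMod.χ₈ n := by
  rw [jacobiSym.at_two (Int.natAbs_odd.mpr hn)]
  obtain ⟨N, rfl | rfl⟩ := n.eq_nat_or_neg
  · simp
  · rw [Int.natAbs_neg, Int.natAbs_natCast, Int.cast_neg, Int.cast_natCast,
      ← neg_one_mul (N : ZMod 8), map_mul, (by decide : ZMod.χ₈ (-1) = 1), one_mul]

section

variable {q : ℕ} [Fact q.Prime] {n k u w : ℤ}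

theorem legendreSym_eq_χ₈_of_mul_eq_sq_sub (hq : q % 4 = 3) (hn : n % 4 = 1)
    (hqn : ¬ (q : ℤ) ∣ n) (h : n * k = u ^ 2 - 2 * q * w ^ 2)
    (hprim : ∀ l : ℤ, Prime l → l ∣ n → l ∣ k → ¬ l ∣ w) : legendreSym q n = ZMod.χ₈ n := by
  have hq_prime : Prime (q : ℤ) := Nat.prime_iff_prime_int.mp Fact.out
  have hn_odd : Odd n := Int.odd_iff.mpr (by omega)
  have h2n : IsCoprime 2 n := Int.isCoprime_two_left.mpr hn_odd
  have hJ : J(2 | n.natAbs) * J(q | n.natAbs) = 1 := by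
    rw [← jacobiSym.mul_left]
    exact jacobiSym_natAbs_eq_one_of_mul_eq_sq_sub
      (h2n.mul_left (hq_prime.coprime_iff_not_dvd.mpr hqn)) h hprim
  have hsq : J(2 | n.natAbs) ^ 2 = 1 :=
    jacobiSym.sq_one (Int.isCoprime_iff_gcd_eq_one.mp h2n : Int.gcd 2 n = 1)
  rw [legendreSym_eq_χ₄_mul_jacobiSym hq hn_odd, ZMod.χ₄_int_one_mod_four hn, one_mul,
    ← jacobiSym_two_natAbs hn_odd]
  linear_combination J(2 | n.natAbs) * hJ - J(q | n.natAbs) * hsq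

theorem legendreSym_eq_χ₄_of_mul_eq_sq_sub (hq : q % 4 = 3) (hn : Odd n) (hqn : ¬ (q : ℤ) ∣ n)
    (h : n * k = u ^ 2 - q * w ^ 2) (hprim : ∀ l : ℤ, Prime l → l ∣ n → l ∣ k → ¬ l ∣ w) :
    legendreSym q n = ZMod.χ₄ n := by
  have hq_prime : Prime (q : ℤ) := Nat.prime_iff_prime_int.mp Fact.out
  rw [legendreSym_eq_χ₄_mul_jacobiSym hq hn, jacobiSym_natAbs_eq_one_of_mul_eq_sq_sub
    (hq_prime.coprime_iff_not_dvd.mpr hqn) h hprim, mul_one]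

theorem legendreSym_neg (hq : q % 4 = 3) (n : ℤ) : legendreSym q (-n) = -legendreSym q n := by
  rw [← neg_one_mul, legendreSym.mul, legendreSym.at_neg_one (by rintro rfl; omega),
    ZMod.χ₄_nat_three_mod_four hq, neg_one_mul]

theorem legendreSym_eq_of_mul_eq_sq_sub (hqn : ¬ (q : ℤ) ∣ n) (hqk : ¬ (q : ℤ) ∣ k)
    (h : n * k = u ^ 2 - q * w ^ 2) : legendreSym q n = legendreSym q k := by
  rw [← ZMod.intCast_zmod_eq_zero_iff_dvd] at hqn hqk
  have hu : (n : ZMod q) * k = u ^ 2 := by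
    have := congrArg (Int.cast : ℤ → ZMod q) h
    push_cast at this
    rw [this, CharP.cast_eq_zero, zero_mul, sub_zero]
  have hu0 : (u : ZMod q) ≠ 0 := fun hu0 =>
    mul_ne_zero hqn hqk (by rw [hu, hu0, zero_pow two_ne_zero])
  have hprod : legendreSym q n * legendreSym q k = 1 := by
    rw [← legendreSym.mul, legendreSym, Int.cast_mul, hu]
    exact quadraticChar_sq_one' hu0
  have hsq := legendreSym.sq_one q hqk
  linear_combination legendreSym q k * hprod - legendreSym q n * hsq

-- Dividing `n` and `u` by `q` swaps the roles of `u` and `w`.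
theorem legendreSym_cofactor_eq_χ₄_of_mul_eq_sq_sub (hq : q % 4 = 3) (hn : Odd n)
    (hqk : ¬ (q : ℤ) ∣ k) (h : n * k = u ^ 2 - q * w ^ 2)
    (hprim : ∀ l : ℤ, Prime l → l ∣ n → l ∣ k → ¬ l ∣ w) : legendreSym q k = ZMod.χ₄ n := by
  have hq_prime : Prime (q : ℤ) := Nat.prime_iff_prime_int.mp Fact.out
  induction hN : n.natAbs using Nat.strong_induction_on generalizing n k u w with
  | _ N ih =>
  by_cases hqn : (q : ℤ) ∣ n
  swap
  · rw [← legendreSym_eq_of_mul_eq_sq_sub hqn hqk h,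
      legendreSym_eq_χ₄_of_mul_eq_sq_sub hq hn hqn h hprim]
  obtain ⟨u, rfl⟩ : (q : ℤ) ∣ u := by
    refine hq_prime.dvd_of_dvd_pow (n := 2) ?_
    rw [show u ^ 2 = n * k + q * w ^ 2 by linarith]
    exact dvd_add (hqn.mul_right k) (dvd_mul_right _ _)
  obtain ⟨n, rfl⟩ := hqn
  have hn' : Odd n := (Int.odd_mul.mp hn).2
  have h' : n * -k = w ^ 2 - q * u ^ 2 := by
    refine mul_left_cancel₀ hq_prime.ne_zero ?_
    linear_combination -h
  have hlt : n.natAbs < N := by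
    rw [← hN, Int.natAbs_mul, Int.natAbs_natCast]
    exact lt_mul_of_one_lt_left (Int.natAbs_pos.mpr (by rintro rfl; simp at hn'))
      (Nat.Prime.one_lt Fact.out)
  have hprim' : ∀ l : ℤ, Prime l → l ∣ n → l ∣ -k → ¬ l ∣ u := by
    refine fun l hl hln hlk hlu => hprim l hl (hln.mul_left _) (dvd_neg.mp hlk) ?_
    refine hl.dvd_of_dvd_pow (n := 2) ?_
    rw [show w ^ 2 = n * -k + q * u * u by linarith]
    exact dvd_add (hln.mul_right _) (hlu.mul_left _)
  have hχ : ZMod.χ₄ ((q * n : ℤ) : ZMod 4) = -ZMod.χ₄ n := by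
    rw [Int.cast_mul, map_mul, Int.cast_natCast, ZMod.χ₄_nat_three_mod_four hq, neg_one_mul]
  rw [hχ, ← ih _ hlt hn' (by rwa [dvd_neg]) h' hprim' rfl, legendreSym_neg hq, neg_neg]

end

theorem four_dvd_of_sq_add_sq_mod_eight {P c d : ℤ} (hP : P % 8 = 1) (hc : Odd c)
    (h : P = c ^ 2 + d ^ 2) : 4 ∣ d := by
  have hd_sq : 8 ∣ d ^ 2 := by
    have := Int.eight_dvd_sq_sub_one_of_odd hc
    omega
  obtain ⟨e, rfl⟩ : 2 ∣ d :=
    Int.prime_two.dvd_of_dvd_pow (dvd_trans (by norm_num) hd_sq)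
  have he : 2 ∣ e := Int.prime_two.dvd_of_dvd_pow (n := 2) (by rw [mul_pow] at hd_sq; omega)
  exact mul_dvd_mul_left 2 he

theorem χ₄_half_add_eq_χ₈_add {P c d x A B : ℤ} (hcd : P = c ^ 2 + d ^ 2)
    (hAB : P = A ^ 2 + 2 * B ^ 2) (hAB' : IsCoprime A B) (hd : 4 ∣ d) (hx : x % 4 = 1)
    (hA : A % 4 = 1) : ZMod.χ₄ ((x + A) / 2 : ℤ) = ZMod.χ₈ (x + d : ℤ) := by
  have hAd_odd : Odd (A + d) := Int.odd_iff.mpr (by omega)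
  have hAd : (A + d) % 8 = 1 := by
    have hJ := jacobiSym_natAbs_eq_one_of_mul_eq_sq_sub (Int.isCoprime_two_left.mpr hAd_odd)
      (show (A + d) * (A - d) = c ^ 2 - 2 * B ^ 2 by linear_combination hcd - hAB)
      fun l hl => not_dvd_of_mul_add_eq_two_mul hl hAd_odd (m := 1) (by ring) hAB'
    rw [jacobiSym_two_natAbs hAd_odd, ZMod.χ₈_int_eq_if_mod_eight] at hJ
    split_ifs at hJ <;> omega
  rw [ZMod.χ₄_int_eq_if_mod_four, ZMod.χ₈_int_eq_if_mod_eight]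
  split_ifs <;> omega

end NormForms

section JacobiSums

variable {F R : Type*} [Field F] [Fintype F] [CommRing R]

theorem apply_four_mul_jacobiSum_self [DecidableEq F] [IsDomain R] (hF : ringChar F ≠ 2)
    {χ : MulChar F R} (hχ : χ ≠ 1) :
    χ 4 * jacobiSum χ χ = jacobiSum χ ((quadraticChar F).ringHomComp (Int.castRingHom R)) := by
  have complete_square : χ 4 * jacobiSum χ χ = ∑ x : F, χ (1 - x ^ 2) := by
    rw [jacobiSum, Finset.mul_sum]
    refine Fintype.sum_equiv ((Equiv.mulLeft₀ 2 (Ring.two_ne_zero hF)).trans (Equiv.subRight 1))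
      _ _ fun x => ?_
    rw [← map_mul, ← map_mul]
    congr 1
    change 4 * (x * (1 - x)) = 1 - (2 * x - 1) ^ 2
    ring
  have sum_over_squares :
      ∑ x : F, χ (1 - x ^ 2) = ∑ t : F, ((quadraticChar F t + 1 : ℤ) : R) * χ (1 - t) := by
    rw [← Finset.sum_fiberwise Finset.univ (fun x : F => x ^ 2)]
    refine Finset.sum_congr rfl fun t _ => ?_
    rw [← quadraticChar_card_sqrts hF t, Finset.sum_congr rfl (g := fun _ => χ (1 - t))
      (fun x hx => by rw [(Finset.mem_filter.mp hx).2]), Finset.sum_const, nsmul_eq_mul,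
      Int.cast_natCast]
    congr 3
    ext x
    simp
  have sum_eq_zero : ∑ t : F, χ (1 - t) = 0 := by
    rw [← MulChar.sum_eq_zero_of_ne_one hχ]
    exact Fintype.sum_equiv (Equiv.subLeft 1) _ _ fun x => rfl
  rw [complete_square, sum_over_squares, jacobiSum_comm, jacobiSum]
  simp only [Int.cast_add, Int.cast_one, add_mul, one_mul, Finset.sum_add_distrib, sum_eq_zero,
    add_zero]
  rfl

-- Substitute `x ↦ x⁻¹`.
theorem jacobiSum_eq_apply_neg_one_mul_jacobiSum_inv (χ ψ : MulChar F R) :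
    jacobiSum χ ψ = ψ (-1) * jacobiSum (χ * ψ)⁻¹ ψ := by
  rw [jacobiSum, jacobiSum, Finset.mul_sum]
  refine Fintype.sum_equiv (Equiv.inv F) _ _ fun x => ?_
  rcases eq_or_ne x 0 with rfl | hx
  · simp [MulChar.map_zero]
  have hψ : ψ (1 - x) = ψ (-1) * ψ x * ψ (1 - x⁻¹) := by
    rw [← map_mul, ← map_mul]
    congr 1
    field_simp
    ring
  rw [Equiv.inv_apply, MulChar.inv_apply', inv_inv, MulChar.mul_apply, hψ]
  ring

theorem jacobiSum_mul_jacobiSum_inv_of_isDomain [IsDomain R] (hchar : ringChar R ≠ ringChar F)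
    {χ ψ : MulChar F R} (hχ : χ ≠ 1) (hψ : ψ ≠ 1) (hχψ : χ * ψ ≠ 1) :
    jacobiSum χ ψ * jacobiSum χ⁻¹ ψ⁻¹ = Fintype.card F := by
  let f := algebraMap R (FractionRing R)
  have hf : Function.Injective f := IsFractionRing.injective _ _
  have hne {θ : MulChar F R} (hθ : θ ≠ 1) : θ.ringHomComp f ≠ 1 :=
    (MulChar.ringHomComp_ne_one_iff hf).mpr hθ
  have hchar' : ringChar (FractionRing R) ≠ ringChar F := by
    have : CharP (FractionRing R) (ringChar R) := charP_of_injective_algebraMap hf _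
    rwa [ringChar.eq (FractionRing R) (ringChar R)]
  apply hf
  rw [map_mul, map_natCast, ← jacobiSum_ringHomComp, ← jacobiSum_ringHomComp,
    ← MulChar.ringHomComp_inv, ← MulChar.ringHomComp_inv]
  exact jacobiSum_mul_jacobiSum_inv hchar' (hne hχ) (hne hψ)
    (by rw [← MulChar.ringHomComp_mul]; exact hne hχψ)

end JacobiSums

section OcticCharacters

variable {F R S : Type*} [Field F] [Fintype F] [DecidableEq F] [CommRing R] [CommRing S]

/-- An octic character: a character whose fourth power is the quadratic character. When
`-1 ≠ 1` in `R` and `F` has odd characteristic, these are the characters of order `8`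
(`IsOctic.orderOf_eq`) that an `8`-th power residue symbol provides. -/
def IsOctic (χ : MulChar F R) : Prop :=
  χ ^ 4 = (quadraticChar F).ringHomComp (Int.castRingHom R)

namespace IsOctic

variable {χ : MulChar F R}

theorem ringHomComp (hχ : IsOctic χ) (f : R →+* S) : IsOctic (χ.ringHomComp f) := by
  rw [IsOctic, MulChar.ringHomComp_pow, hχ]
  ext a
  simp [MulChar.ringHomComp_apply]

theorem orderOf_eq (hχ : IsOctic χ) (hF : ringChar F ≠ 2) (hR : (-1 : R) ≠ 1) :
    orderOf χ = 8 := by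
  refine orderOf_eq_prime_pow (p := 2) (n := 2) ?_ ?_
  · obtain ⟨a, ha⟩ := quadraticChar_exists_neg_one' hF
    intro h
    rw [show (2 : ℕ) ^ 2 = 4 from rfl, hχ] at h
    have := congrArg (· (a : F)) h
    simp [MulChar.ringHomComp_apply, ha, hR] at this
  · rw [show 2 ^ (2 + 1) = 4 * 2 from rfl, pow_mul, hχ, MulChar.ringHomComp_pow,
      (quadraticChar_isQuadratic F).sq_eq_one, MulChar.ringHomComp_one]

theorem pow_eq_one_iff (hχ : IsOctic χ) (hF : ringChar F ≠ 2) (hR : (-1 : R) ≠ 1) {n : ℕ} :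
    χ ^ n = 1 ↔ 8 ∣ n := by
  rw [← hχ.orderOf_eq hF hR, orderOf_dvd_iff_pow_eq_one]

end IsOctic

end OcticCharacters

section EighthRoots

theorem X_pow_four_add_one_eq_cyclotomic : (X ^ 4 + 1 : ℤ[X]) = cyclotomic 8 ℤ := by
  have := cyclotomic_prime_pow_eq_geom_sum (R := ℤ) (n := 2) Nat.prime_two
  norm_num [Finset.sum_range_succ] at this
  rw [this, add_comm]

theorem isPrimitiveRoot_eight_of_pow_four_eq_neg_one {R : Type*} [CommRing R] (hR : (-1 : R) ≠ 1)
    {z : R} (hz : z ^ 4 = -1) : IsPrimitiveRoot z 8 := by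
  rw [IsPrimitiveRoot.iff_orderOf]
  refine orderOf_eq_prime_pow (p := 2) (n := 2) ?_ ?_
  · simpa [hz] using hR
  · rw [show 2 ^ (2 + 1) = 4 * 2 from rfl, pow_mul, hz, neg_one_sq]

/-- The ring `ℤ[ζ₈]` of integers of the eighth cyclotomic field, in which octic Jacobi sums
live. -/
abbrev ZetaEight : Type := AdjoinRoot (X ^ 4 + 1 : ℤ[X])

namespace ZetaEight

instance : IsDomain ZetaEight := AdjoinRoot.isDomain_of_prime (by
  rw [X_pow_four_add_one_eq_cyclotomic]
  exact (cyclotomic.irreducible (by norm_num)).prime)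

/-- The eighth root of unity that generates `ZetaEight`. -/
noncomputable abbrev ζ : ZetaEight := AdjoinRoot.root (X ^ 4 + 1 : ℤ[X])

theorem ζ_pow_four : ζ ^ 4 = -1 := by
  have := AdjoinRoot.eval₂_root (X ^ 4 + 1 : ℤ[X])
  simp only [eval₂_add, eval₂_pow, eval₂_X, eval₂_one] at this
  exact eq_neg_of_add_eq_zero_left this

theorem exists_rep (s : ZetaEight) :
    ∃ a b c d : ℤ, s = a + b * ζ + c * ζ ^ 2 + d * ζ ^ 3 := by
  induction s using AdjoinRoot.induction_on with
  | _ P =>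
  induction P using Polynomial.induction_on with
  | C a => exact ⟨a, 0, 0, 0, by simp⟩
  | add P Q hP hQ =>
    obtain ⟨a, b, c, d, h⟩ := hP
    obtain ⟨a', b', c', d', h'⟩ := hQ
    refine ⟨a + a', b + b', c + c', d + d', ?_⟩
    rw [map_add, h, h']
    push_cast
    ring
  | monomial n k h =>
    obtain ⟨a, b, c, d, h⟩ := h
    refine ⟨-d, a, b, c, ?_⟩
    rw [show C k * X ^ (n + 1) = C k * X ^ n * X by ring, map_mul, h, AdjoinRoot.mk_X]
    push_cast
    linear_combination (d : ZetaEight) * ζ_pow_four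

theorem eq_zero_of_rep {a b c d : ℤ}
    (h : (a : ZetaEight) + b * ζ + c * ζ ^ 2 + d * ζ ^ 3 = 0) : a = 0 ∧ b = 0 ∧ c = 0 ∧ d = 0 := by
  set P : ℤ[X] := C a + C b * X + C c * X ^ 2 + C d * X ^ 3 with hP
  have hmk : AdjoinRoot.mk (X ^ 4 + 1 : ℤ[X]) P = 0 := by
    rw [hP]
    simpa using h
  have hP0 : P = 0 := by
    refine eq_zero_of_dvd_of_natDegree_lt (AdjoinRoot.mk_eq_zero.mp hmk) ?_
    rw [show (X ^ 4 + 1 : ℤ[X]).natDegree = 4 by compute_degree!]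
    refine Nat.lt_succ_of_le ?_
    rw [hP]
    compute_degree
  have coeff_eq_zero (n : ℕ) : P.coeff n = 0 := by rw [hP0, coeff_zero]
  refine ⟨?_, ?_, ?_, ?_⟩
  · simpa [-eq_intCast, hP, coeff_X, coeff_C] using coeff_eq_zero 0
  · simpa [-eq_intCast, hP, coeff_X, coeff_C] using coeff_eq_zero 1
  · simpa [-eq_intCast, hP, coeff_X, coeff_C] using coeff_eq_zero 2
  · simpa [-eq_intCast, hP, coeff_X, coeff_C] using coeff_eq_zero 3

instance : CharZero ZetaEight := charZero_of_inj_zero fun n hn => by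
  have := (eq_zero_of_rep (a := n) (b := 0) (c := 0) (d := 0) (by simpa using hn)).1
  exact_mod_cast this

/-- The ring homomorphism out of `ℤ[ζ₈]` sending `ζ` to a given root of `X⁴ + 1`. -/
noncomputable def lift {R : Type*} [CommRing R] (z : R) (hz : z ^ 4 = -1) : ZetaEight →+* R :=
  AdjoinRoot.lift (Int.castRingHom R) z (by simp [hz])

@[simp]
theorem lift_ζ {R : Type*} [CommRing R] (z : R) (hz : z ^ 4 = -1) : lift z hz ζ = z :=
  AdjoinRoot.lift_root _

/-- The Galois conjugation `ζ ↦ ζ ^ j` of `ℤ[ζ₈]`, for odd `j`. -/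
noncomputable def galois (j : ℕ) (hj : Odd j) : ZetaEight →+* ZetaEight :=
  lift (ζ ^ j) (by rw [pow_right_comm, ζ_pow_four, hj.neg_one_pow])

@[simp]
theorem galois_ζ (j : ℕ) (hj : Odd j) : galois j hj ζ = ζ ^ j :=
  lift_ζ _ _

theorem exists_eq_of_mem_adjoin_ζ_sq {s : ZetaEight} (hs : s ∈ Algebra.adjoin ℤ {ζ ^ 2}) :
    ∃ a b : ℤ, s = a + b * ζ ^ 2 := by
  induction hs using Algebra.adjoin_induction with
  | mem s hs => exact ⟨0, 1, by simpa using hs⟩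
  | algebraMap n => exact ⟨n, 0, by simp⟩
  | add s t _ _ hs ht =>
    obtain ⟨a, b, rfl⟩ := hs
    obtain ⟨a', b', rfl⟩ := ht
    exact ⟨a + a', b + b', by push_cast; ring⟩
  | mul s t _ _ hs ht =>
    obtain ⟨a, b, rfl⟩ := hs
    obtain ⟨a', b', rfl⟩ := ht
    refine ⟨a * a' - b * b', a * b' + b * a', ?_⟩
    push_cast
    linear_combination (b * b' : ZetaEight) * ζ_pow_four

theorem exists_eq_of_galois_three_eq {s : ZetaEight} (hs : galois 3 (by decide) s = s) :
    ∃ A B : ℤ, s = A + B * (ζ + ζ ^ 3) := by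
  obtain ⟨a, b, c, d, rfl⟩ := exists_rep s
  simp only [map_add, map_mul, map_intCast, map_pow, galois_ζ] at hs
  obtain ⟨-, hbd, hc, -⟩ : (0 : ℤ) = 0 ∧ b - d = 0 ∧ 2 * c = 0 ∧ d - b = 0 := by
    apply eq_zero_of_rep
    push_cast
    linear_combination -hs + (c * ζ ^ 2 + d * ζ * (ζ ^ 4 - 1)) * ζ_pow_four
  obtain rfl : b = d := by omega
  obtain rfl : c = 0 := by omega
  exact ⟨a, b, by push_cast; ring⟩

theorem mul_galois_seven_add_mul_sqrt_neg_two (A B : ℤ) :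
    (A + B * (ζ + ζ ^ 3)) * galois 7 (by decide) (A + B * (ζ + ζ ^ 3)) =
      ((A ^ 2 + 2 * B ^ 2 : ℤ) : ZetaEight) := by
  simp only [map_add, map_mul, map_intCast, map_pow, galois_ζ]
  push_cast
  rw [show ζ ^ 7 = -ζ ^ 3 by linear_combination ζ ^ 3 * ζ_pow_four]
  linear_combination
    (A * B * ζ * (1 - ζ ^ 4) - B ^ 2 * (ζ ^ 8 + ζ ^ 6 - ζ ^ 4 + 2)) * ζ_pow_four

theorem mul_galois_seven_add_mul_sqrt_neg_one (a b : ℤ) :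
    (a + b * ζ ^ 2) * galois 7 (by decide) (a + b * ζ ^ 2) =
      ((a ^ 2 + b ^ 2 : ℤ) : ZetaEight) := by
  simp only [map_add, map_mul, map_intCast, map_pow, galois_ζ]
  push_cast
  rw [show ζ ^ 7 = -ζ ^ 3 by linear_combination ζ ^ 3 * ζ_pow_four]
  linear_combination (a * b * ζ ^ 2 + b ^ 2 * (ζ ^ 4 - 1)) * ζ_pow_four

end ZetaEight

end EighthRoots

section OcticJacobiSums

variable {F : Type*} [Field F] [Fintype F]

theorem jacobiSum_pow_three_pow_four {R : Type*} [CommRing R] {χ : MulChar F R} (hχ : χ ^ 8 = 1) :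
    jacobiSum (χ ^ 3) (χ ^ 4) = jacobiSum χ (χ ^ 4) := by
  have reflect {m n : ℕ} (hmn : m + (4 + n) = 8) :
      jacobiSum (χ ^ 4) (χ ^ n) = (χ ^ n) (-1) * jacobiSum (χ ^ m) (χ ^ n) := by
    rw [jacobiSum_eq_apply_neg_one_mul_jacobiSum_inv, ← pow_add,
      ← eq_inv_of_mul_eq_one_left (a := χ ^ m) (by rw [← pow_add, hmn, hχ])]
  have parity : (χ ^ 3) (-1) = (χ ^ 1) (-1) := by
    rw [MulChar.pow_apply' _ three_ne_zero, pow_one, pow_succ, ← map_pow, neg_one_sq, map_one,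
      one_mul]
  conv_rhs => rw [← pow_one χ, ← pow_mul, one_mul]
  rw [jacobiSum_comm, reflect (m := 1) rfl, jacobiSum_comm (χ ^ 1) (χ ^ 4),
    reflect (m := 3) rfl, parity, jacobiSum_comm]

namespace IsOctic

open ZetaEight

variable [DecidableEq F] {χ : MulChar F ZetaEight}

theorem ringHomComp_galois (hχ : IsOctic χ) (hF : ringChar F ≠ 2) (j : ℕ) (hj : Odd j) :
    χ.ringHomComp (galois j hj) = χ ^ j := by
  have hχ8 : χ ^ 8 = 1 := (hχ.pow_eq_one_iff hF (by norm_num)).mpr dvd_rfl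
  ext a
  obtain ⟨k, -, hk⟩ := MulChar.exists_apply_eq_pow hχ8
    (isPrimitiveRoot_eight_of_pow_four_eq_neg_one (by norm_num) ζ_pow_four) a.ne_zero
  rw [MulChar.ringHomComp_apply, MulChar.pow_apply_coe, hk, map_pow, galois_ζ, pow_right_comm]

theorem galois_jacobiSum (hχ : IsOctic χ) (hF : ringChar F ≠ 2) (j : ℕ) (hj : Odd j) (m n : ℕ) :
    galois j hj (jacobiSum (χ ^ m) (χ ^ n)) = jacobiSum ((χ ^ m) ^ j) ((χ ^ n) ^ j) := by
  rw [← jacobiSum_ringHomComp, ← MulChar.ringHomComp_pow, ← MulChar.ringHomComp_pow,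
    hχ.ringHomComp_galois hF, pow_right_comm, pow_right_comm χ j n]

theorem jacobiSum_mul_galois_seven (hχ : IsOctic χ) (hF : ringChar F ≠ 2) {m n : ℕ}
    (hm : ¬ 8 ∣ m) (hn : ¬ 8 ∣ n) (hmn : ¬ 8 ∣ m + n) :
    jacobiSum (χ ^ m) (χ ^ n) * galois 7 (by decide) (jacobiSum (χ ^ m) (χ ^ n)) =
      Fintype.card F := by
  have pow_eq_one {k : ℕ} : χ ^ k = 1 ↔ 8 ∣ k := hχ.pow_eq_one_iff hF (by norm_num)
  have pow_seven (k : ℕ) : (χ ^ k) ^ 7 = (χ ^ k)⁻¹ := eq_inv_of_mul_eq_one_left <| by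
    rw [← pow_succ, ← pow_mul, pow_eq_one]
    exact dvd_mul_left _ _
  rw [hχ.galois_jacobiSum hF, pow_seven, pow_seven]
  refine jacobiSum_mul_jacobiSum_inv_of_isDomain ?_ (pow_eq_one.not.mpr hm)
    (pow_eq_one.not.mpr hn) (by rwa [← pow_add, Ne, pow_eq_one])
  rw [ringChar.eq_zero]
  exact (CharP.ringChar_ne_zero_of_finite F).symm

theorem exists_jacobiSum_pow_four_eq (hχ : IsOctic χ) (hF : ringChar F ≠ 2) :
    ∃ A B : ℤ, A ^ 2 + 2 * B ^ 2 = Fintype.card F ∧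
      jacobiSum χ (χ ^ 4) = A + B * (ζ + ζ ^ 3) := by
  have hχ8 : χ ^ 8 = 1 := (hχ.pow_eq_one_iff hF (by norm_num)).mpr dvd_rfl
  have fixed : galois 3 (by decide) (jacobiSum (χ ^ 1) (χ ^ 4)) = jacobiSum (χ ^ 1) (χ ^ 4) := by
    rw [hχ.galois_jacobiSum hF, pow_one, show (χ ^ 4) ^ 3 = χ ^ 4 by
      rw [← pow_mul, show 4 * 3 = 8 + 4 from rfl, pow_add, hχ8, one_mul],
      jacobiSum_pow_three_pow_four hχ8]
  have norm := hχ.jacobiSum_mul_galois_seven hF (m := 1) (n := 4)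
    (by norm_num) (by norm_num) (by norm_num)
  obtain ⟨A, B, hAB⟩ := exists_eq_of_galois_three_eq fixed
  rw [hAB, mul_galois_seven_add_mul_sqrt_neg_two] at norm
  exact ⟨A, B, by exact_mod_cast norm, by rw [← hAB, pow_one]⟩

theorem exists_jacobiSum_sq_pow_four_eq (hχ : IsOctic χ) (hF : 8 ∣ Fintype.card F - 1)
    (hF2 : ringChar F ≠ 2) :
    ∃ a b : ℤ, a ^ 2 + b ^ 2 = Fintype.card F ∧ Odd a ∧ Even b ∧
      jacobiSum (χ ^ 2) (χ ^ 4) = a + b * ζ ^ 2 := by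
  have pow_eq_one {k : ℕ} : χ ^ k = 1 ↔ 8 ∣ k := hχ.pow_eq_one_iff hF2 (by norm_num)
  obtain ⟨z, hz, hJ⟩ := exists_jacobiSum_eq_neg_one_add (n := 4) (by norm_num)
    (χ := χ ^ 2) (ψ := χ ^ 4) (by rw [← pow_mul, pow_eq_one])
    (by rw [← pow_mul, pow_eq_one]; norm_num) (dvd_trans (by norm_num) hF)
    ((isPrimitiveRoot_eight_of_pow_four_eq_neg_one (by norm_num) ζ_pow_four).pow (by norm_num)
      (show 8 = 2 * 4 from rfl))
  obtain ⟨s, t, rfl⟩ := exists_eq_of_mem_adjoin_ζ_sq hz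
  have hJ' : jacobiSum (χ ^ 2) (χ ^ 4) = ((2 * t - 1 : ℤ) : ZetaEight) + (-2 * s : ℤ) * ζ ^ 2 := by
    rw [hJ]
    push_cast
    linear_combination (s + t * ζ ^ 2 - 2 * t) * ζ_pow_four
  have norm := hχ.jacobiSum_mul_galois_seven hF2 (m := 2) (n := 4)
    (by norm_num) (by norm_num) (by norm_num)
  rw [hJ', mul_galois_seven_add_mul_sqrt_neg_one] at norm
  exact ⟨2 * t - 1, -2 * s, by exact_mod_cast norm, ⟨t - 1, by ring⟩, ⟨-s, by ring⟩, hJ'⟩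

end IsOctic

theorem sum_eval_eq_zero_of_natDegree_lt {P : F[X]}
    (hP : P.natDegree < Fintype.card F - 1) : ∑ x : F, P.eval x = 0 := by
  simp only [eval_eq_sum_range]
  rw [Finset.sum_comm]
  refine Finset.sum_eq_zero fun i hi => ?_
  rw [← Finset.mul_sum, FiniteField.sum_pow_lt_card_sub_one, mul_zero]
  have := Finset.mem_range.mp hi
  omega

theorem jacobiSum_sq_pow_four_eq_zero_of_apply_eq_pow {χ : MulChar F F} {e : ℕ}
    (hF : 6 * e < Fintype.card F - 1) (hχ : ∀ x, χ x = x ^ e) : jacobiSum (χ ^ 2) (χ ^ 4) = 0 := by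
  rw [← sum_eval_eq_zero_of_natDegree_lt (P := (X ^ e) ^ 2 * ((1 - X) ^ e) ^ 4), jacobiSum]
  · refine Finset.sum_congr rfl fun x _ => ?_
    rw [MulChar.pow_apply' _ two_ne_zero, MulChar.pow_apply' _ four_ne_zero, hχ, hχ]
    simp
  · refine lt_of_le_of_lt ?_ hF
    rw [← pow_mul, ← pow_mul, show 6 * e = e * 2 + e * 4 by ring]
    compute_degree

end OcticJacobiSums

section OcticResidueCharacter

variable {F : Type*} [Field F] [Fintype F]

open ZetaEight

theorem ringChar_ne_two_of_odd_card (hF : Odd (Fintype.card F)) : ringChar F ≠ 2 := fun h =>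
  Nat.not_even_iff_odd.mpr hF (Nat.even_iff.mpr (FiniteField.even_card_of_char_two h))

theorem isOctic_of_lift_apply_eq_pow [DecidableEq F] {χ : MulChar F ZetaEight} {e : ℕ} {w : F}
    {hw : w ^ 4 = -1} (he : Fintype.card F = 8 * e + 1) (hχ8 : χ ^ 8 = 1)
    (hχ : ∀ x, lift w hw (χ x) = x ^ e) : IsOctic χ := by
  have hF : ringChar F ≠ 2 := ringChar_ne_two_of_odd_card (he ▸ ⟨4 * e, by ring⟩)
  ext a
  obtain ⟨k, -, hk⟩ := MulChar.exists_apply_eq_pow hχ8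
    (isPrimitiveRoot_eight_of_pow_four_eq_neg_one (by norm_num) ζ_pow_four) a.ne_zero
  have euler : (quadraticChar F a : F) = ((-1) ^ k : ℤ) := by
    rw [quadraticChar_eq_pow_of_char_ne_two' hF, show Fintype.card F / 2 = e * 4 by omega,
      pow_mul, ← hχ, hk, map_pow, lift_ζ, pow_right_comm, hw]
    push_cast
    rfl
  have quadraticChar_eq : quadraticChar F a = (-1) ^ k := by
    refine Int.cast_injOn_of_ringChar_ne_two hF ?_ ?_ euler
    · rcases quadraticChar_dichotomy a.ne_zero with h | h <;> simp [h]
    · rcases neg_one_pow_eq_or ℤ k with h | h <;> simp [h]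
  rw [MulChar.pow_apply_coe, hk, pow_right_comm, ζ_pow_four, MulChar.ringHomComp_apply,
    quadraticChar_eq]
  simp

theorem exists_lift_apply_eq_pow {e : ℕ} (he : Fintype.card F = 8 * e + 1) {w : F}
    (hw : w ^ 4 = -1) :
    ∃ χ : MulChar F ZetaEight, χ ^ 8 = 1 ∧ ∀ x, lift w hw (χ x) = x ^ e := by
  classical
  have hF : ringChar F ≠ 2 := ringChar_ne_two_of_odd_card (he ▸ ⟨4 * e, by ring⟩)
  have he0 : e ≠ 0 := by
    rintro rfl
    exact Fintype.one_lt_card.ne' he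
  have card_units : Fintype.card Fˣ = 8 * e := by rw [Fintype.card_units, he]; rfl
  obtain ⟨g, hg⟩ := IsCyclic.exists_generator (α := Fˣ)
  obtain ⟨k, -, hk⟩ := (isPrimitiveRoot_eight_of_pow_four_eq_neg_one
    (Ring.neg_one_ne_one_of_char_ne_two hF) hw).eq_pow_of_pow_eq_one (ξ := (g : F) ^ e)
    (by rw [← pow_mul, mul_comm, ← card_units, ← Units.val_pow_eq_pow_val, pow_card_eq_one,
      Units.val_one])
  have ζ_pow_eight : ζ ^ 8 = 1 := by
    rw [show 8 = 4 * 2 from rfl, pow_mul, ζ_pow_four, neg_one_sq]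
  have ofPowEqOne_pow_eight : Units.ofPowEqOne ζ 8 ζ_pow_eight (by norm_num) ^ 8 = 1 :=
    Units.ext ζ_pow_eight
  set χ := MulChar.ofRootOfUnity (M := F)
    (ζ := Units.ofPowEqOne ζ 8 ζ_pow_eight (by norm_num) ^ k)
    (by rw [mem_rootsOfUnity, card_units, pow_right_comm, pow_mul, ofPowEqOne_pow_eight,
      one_pow, one_pow]) hg
  have hχg : χ g = ζ ^ k := MulChar.ofRootOfUnity_spec _ hg
  refine ⟨χ, ?_, fun x => ?_⟩
  · rw [MulChar.eq_iff hg, MulChar.pow_apply_coe, hχg, pow_right_comm, ζ_pow_eight, one_pow,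
      MulChar.one_apply_coe]
  · rcases eq_or_ne x 0 with rfl | hx
    · rw [MulChar.map_zero, map_zero, zero_pow he0]
    obtain ⟨n, hn⟩ := mem_powers_iff_mem_zpowers.mpr (hg (Units.mk0 x hx))
    have hx : x = (g : F) ^ n := (congrArg Units.val hn).symm
    rw [hx, map_pow, map_pow, hχg, map_pow, lift_ζ, hk, pow_right_comm]

theorem eq_or_eq_neg_of_sq_add_sq_eq {n a b c d : ℤ} (hab : a ^ 2 + b ^ 2 = n)
    (hcd : c ^ 2 + d ^ 2 = n) (ha : Odd a) (hb : Even b) (hc : Odd c) (hdvd : n ∣ a * d - b * c) :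
    a = c ∧ b = d ∨ a = -c ∧ b = -d := by
  have hn : 0 < n := by
    have : a ≠ 0 := fun h => by simp [h] at ha
    rw [← hab]
    positivity
  have odd_inner : Odd (a * c + b * d) := (ha.mul hc).add_even (hb.mul_right d)
  obtain ⟨t, ht⟩ := hdvd
  have brahmagupta : (a * c + b * d) ^ 2 + (n * t) ^ 2 = n ^ 2 := by
    rw [← ht, sq n]
    nth_rw 1 [← hab]
    rw [← hcd]
    ring
  have inner_pos : 0 < (a * c + b * d) ^ 2 := by
    have : a * c + b * d ≠ 0 := fun h => by simp [h] at odd_inner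
    positivity
  obtain rfl : t = 0 := by
    by_contra h
    have : 1 ≤ t ^ 2 := by have := sq_pos_of_ne_zero h; omega
    nlinarith
  have ha_mul : a * n = c * (a * c + b * d) := by linear_combination d * ht - a * hcd
  have hb_mul : b * n = d * (a * c + b * d) := by linear_combination -c * ht - b * hcd
  rcases sq_eq_sq_iff_eq_or_eq_neg.mp (show (a * c + b * d) ^ 2 = n ^ 2 by
    linear_combination brahmagupta) with h | h <;> rw [h] at ha_mul hb_mul
  · exact .inl ⟨mul_right_cancel₀ hn.ne' ha_mul, mul_right_cancel₀ hn.ne' hb_mul⟩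
  · exact .inr ⟨mul_right_cancel₀ hn.ne' (by linear_combination ha_mul),
      mul_right_cancel₀ hn.ne' (by linear_combination hb_mul)⟩

theorem jacobiSum_sq_pow_four_sq_eq {p e : ℕ} [Fact p.Prime] (he : p = 8 * e + 1) {c d : ℤ}
    (hcd : c ^ 2 + d ^ 2 = p) (hc : Odd c) {w : ZMod p} {hw : w ^ 4 = -1}
    (hcdw : (c : ZMod p) + d * w ^ 2 = 0) {χ : MulChar (ZMod p) ZetaEight} (hχ : IsOctic χ)
    (hχw : ∀ x, lift w hw (χ x) = x ^ e) :
    jacobiSum (χ ^ 2) (χ ^ 4) ^ 2 = (c + d * ζ ^ 2) ^ 2 := by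
  have hcard : Fintype.card (ZMod p) = 8 * e + 1 := (ZMod.card p).trans he
  obtain ⟨a, b, hab, ha, hb, hJ⟩ := hχ.exists_jacobiSum_sq_pow_four_eq ⟨e, by omega⟩
    (ringChar_ne_two_of_odd_card (hcard ▸ ⟨4 * e, by ring⟩))
  have lift_jacobiSum : (a : ZMod p) + b * w ^ 2 = 0 := by
    have := jacobiSum_sq_pow_four_eq_zero_of_apply_eq_pow (χ := χ.ringHomComp (lift w hw)) (e := e)
      (by have := Fintype.one_lt_card (α := ZMod p); omega) hχw
    rw [MulChar.ringHomComp_pow, MulChar.ringHomComp_pow, jacobiSum_ringHomComp, hJ] at this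
    simpa using this
  have hdvd : (p : ℤ) ∣ a * d - b * c := by
    rw [← ZMod.intCast_zmod_eq_zero_iff_dvd]
    push_cast
    linear_combination (d : ZMod p) * lift_jacobiSum - b * hcdw
  rw [ZMod.card] at hab
  rw [hJ]
  rcases eq_or_eq_neg_of_sq_add_sq_eq hab hcd ha hb hc hdvd with ⟨rfl, rfl⟩ | ⟨rfl, rfl⟩
  · rfl
  · push_cast
    ring

end OcticResidueCharacter

section GaussSums

variable {F K : Type*} [Field F] [Fintype F] [Field K]

theorem gaussSum_pow_eight [DecidableEq F] {χ : MulChar F K} (hχ : IsOctic χ)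
    (hF : ringChar F ≠ 2) (hK : (-1 : K) ≠ 1) {ψ : AddChar F K} (hψ : ψ.IsPrimitive) :
    gaussSum χ ψ ^ 8 =
      Fintype.card F * jacobiSum χ (χ ^ 4) ^ 4 * jacobiSum (χ ^ 2) (χ ^ 4) ^ 2 := by
  have pow_ne_one {n : ℕ} (hn : ¬ 8 ∣ n) : χ ^ n ≠ 1 := (hχ.pow_eq_one_iff hF hK).not.mpr hn
  have gaussSum_sq_eq {n : ℕ} (hn : ¬ 8 ∣ n + n) :
      gaussSum (χ ^ n) ψ ^ 2 = gaussSum (χ ^ (n + n)) ψ * jacobiSum (χ ^ n) (χ ^ n) := by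
    rw [sq, pow_add, jacobiSum_mul_nontrivial (by rw [← pow_add]; exact pow_ne_one hn)]
  have gaussSum_pow_four_sq : gaussSum (χ ^ 4) ψ ^ 2 = Fintype.card F := by
    rw [gaussSum_sq (pow_ne_one (by norm_num)) ?_ hψ, MulChar.pow_apply' _ four_ne_zero, ← map_pow,
      Even.neg_one_pow (by decide), map_one, one_mul]
    rw [hχ]
    exact (quadraticChar_isQuadratic F).comp _
  have apply_four_pow_four : χ 4 ^ 4 = 1 := by
    rw [show (4 : F) = 2 ^ 2 by norm_num, map_pow, ← pow_mul, ← MulChar.pow_apply' _ (by norm_num),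
      (hχ.pow_eq_one_iff hF hK).mpr dvd_rfl, MulChar.one_apply (Ring.two_ne_zero hF).isUnit]
  have jacobiSum_self : χ 4 * jacobiSum χ χ = jacobiSum χ (χ ^ 4) := by
    rw [hχ, apply_four_mul_jacobiSum_self hF]
    simpa using pow_ne_one (n := 1) (by norm_num)
  have jacobiSum_sq_self :
      χ 4 ^ 2 * jacobiSum (χ ^ 2) (χ ^ 2) = jacobiSum (χ ^ 2) (χ ^ 4) := by
    rw [hχ, ← MulChar.pow_apply' _ two_ne_zero,
      apply_four_mul_jacobiSum_self hF (pow_ne_one (by norm_num))]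
  have sq_one := gaussSum_sq_eq (n := 1) (by norm_num)
  have sq_two := gaussSum_sq_eq (n := 2) (by norm_num)
  rw [pow_one] at sq_one
  calc gaussSum χ ψ ^ 8 = (gaussSum χ ψ ^ 2) ^ 4 := by ring
    _ = (gaussSum (χ ^ 2) ψ ^ 2) ^ 2 * jacobiSum χ χ ^ 4 := by rw [sq_one]; ring
    _ = gaussSum (χ ^ 4) ψ ^ 2 * jacobiSum χ χ ^ 4 * jacobiSum (χ ^ 2) (χ ^ 2) ^ 2 := by
      rw [sq_two]; ring
    _ = _ := by
      rw [gaussSum_pow_four_sq, ← jacobiSum_self, ← jacobiSum_sq_self]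
      linear_combination -(χ 4 ^ 4 + 1) * Fintype.card F * jacobiSum χ χ ^ 4 *
        jacobiSum (χ ^ 2) (χ ^ 2) ^ 2 * apply_four_pow_four

theorem gaussSum_pow_succ_char {q : ℕ} [Fact q.Prime] [CharP K q] (hq : IsUnit (q : F))
    {χ : MulChar F K} (hχ : χ ≠ 1) (hχq : χ ^ (q + 1) = 1) {ψ : AddChar F K}
    (hψ : ψ.IsPrimitive) : gaussSum χ ψ ^ (q + 1) = χ (-q) * Fintype.card F := by
  have frobenius : gaussSum χ ψ ^ q = χ q * gaussSum χ⁻¹ ψ := by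
    rw [gaussSum_frob, eq_inv_of_mul_eq_one_left ((pow_succ χ q).symm.trans hχq),
      AddChar.pow_mulShift, ← hq.unit_spec, gaussSum_mulShift_eq, inv_inv]
  rw [pow_succ, frobenius, ← gaussSum_mul_gaussSum_eq_card hχ hψ,
    ← mul_gaussSum_inv_eq_gaussSum χ⁻¹ ψ, MulChar.inv_apply', inv_neg, inv_one,
    neg_eq_neg_one_mul (q : F), map_mul]
  ring

theorem apply_neg_mul_card_eq_gaussSum_pow_eight_pow {q : ℕ} [Fact q.Prime] [CharP K q]
    (hq : q % 8 = 7) (hqF : IsUnit (q : F)) (hF : ringChar F ≠ 2) [DecidableEq F]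
    {χ : MulChar F K} (hχ : IsOctic χ) {ψ : AddChar F K} (hψ : ψ.IsPrimitive) :
    χ (-q) * Fintype.card F = (gaussSum χ ψ ^ 8) ^ ((q + 1) / 8) := by
  have hK : (-1 : K) ≠ 1 := Ring.neg_one_ne_one_of_char_ne_two
    (by rw [ringChar.eq K q]; rintro rfl; omega)
  have hdvd : 8 ∣ q + 1 := by omega
  have hχ1 : χ ≠ 1 := by
    simpa using (hχ.pow_eq_one_iff hF hK (n := 1)).not.mpr (by norm_num)
  rw [← pow_mul, Nat.mul_div_cancel' hdvd,
    gaussSum_pow_succ_char hqF hχ1 ((hχ.pow_eq_one_iff hF hK).mpr hdvd) hψ]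

end GaussSums

section HalfPowers

variable {q : ℕ} [Fact q.Prime]

theorem legendreSym_two_mul (hq : q % 8 = 7) (n : ℤ) :
    legendreSym q (2 * n) = legendreSym q n := by
  rw [legendreSym.mul, legendreSym.at_two (by rintro rfl; omega), ZMod.χ₈_nat_eq_if_mod_eight,
    if_neg (by omega), if_pos (.inr hq), one_mul]

variable {K : Type*} [Field K] [CharP K q]

theorem intCast_pow_half_eq_legendreSym (n : ℤ) : (n : K) ^ (q / 2) = legendreSym q n := by
  have := congrArg (ZMod.castHom (dvd_refl q) K) (legendreSym.eq_pow q n)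
  rw [map_intCast, map_pow, map_intCast] at this
  exact this.symm

theorem intCast_pow_char (n : ℤ) : (n : K) ^ q = n := by
  rw [← frobenius_def, map_intCast]

theorem pow_char_eq_legendreSym_mul_of_sq_eq (hq : q ≠ 2) {w : K} {n : ℤ} (hw : w ^ 2 = n) :
    w ^ q = legendreSym q n * w := by
  have hq_odd : q = 2 * (q / 2) + 1 := by
    have := Nat.odd_iff.mp ((Fact.out : q.Prime).odd_of_ne_two hq)
    omega
  rw [← intCast_pow_half_eq_legendreSym, ← hw, ← pow_mul, ← pow_succ, ← hq_odd]

-- `((x + A) + w) ^ 2 = 2 (x + A) (A + w)`, and `(x + A) + w` has norm `2 (x + A) x`.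
theorem add_pow_half_eq_mul_legendreSym (hq : q ≠ 2) {w : K} (hw : w ^ q = -w) {x A : ℤ}
    (hnorm : (A : K) ^ 2 - w ^ 2 = (x : K) ^ 2) (hxA : ¬ (q : ℤ) ∣ x + A) :
    ((A : K) + w) ^ ((q + 1) / 2) = x * legendreSym q (2 * (x + A)) := by
  have hq_odd := Nat.odd_iff.mp ((Fact.out : q.Prime).odd_of_ne_two hq)
  set s : ℤ := 2 * (x + A) with hs
  have hqs : ¬ (q : ℤ) ∣ s := by
    rw [hs, (Nat.prime_iff_prime_int.mp Fact.out).dvd_mul, not_or]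
    refine ⟨fun h => hq ?_, hxA⟩
    exact (Nat.prime_dvd_prime_iff_eq Fact.out Nat.prime_two).mp (by exact_mod_cast h)
  have hs0 : (s : K) ≠ 0 := by rwa [Ne, CharP.intCast_eq_zero_iff K q]
  have hsq : ((x + A : ℤ) + w) ^ 2 = s * (A + w) := by
    rw [hs]
    push_cast
    linear_combination -hnorm
  have hpow_succ : ((x + A : ℤ) + w) ^ (q + 1) = s * x := by
    rw [pow_succ, add_pow_char, intCast_pow_char, hw, hs]
    push_cast
    linear_combination hnorm
  have hpow_half : (s : K) ^ ((q + 1) / 2) = s * legendreSym q s := by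
    rw [← intCast_pow_half_eq_legendreSym, ← pow_succ']
    congr 1
    omega
  have hleg : (legendreSym q s : K) ^ 2 = 1 := by
    rw [← ZMod.intCast_zmod_eq_zero_iff_dvd] at hqs
    exact_mod_cast congrArg (Int.cast : ℤ → K) (legendreSym.sq_one q hqs)
  have key : s * legendreSym q s * ((A : K) + w) ^ ((q + 1) / 2) = s * x := by
    rw [← hpow_half, ← mul_pow, ← hsq, ← pow_mul, ← hpow_succ]
    congr 1
    omega
  apply mul_left_cancel₀ hs0
  linear_combination (legendreSym q s : K) * key - s * ((A : K) + w) ^ ((q + 1) / 2) * hleg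

theorem add_mul_sqrt_neg_one_pow_half_of_not_dvd (hq : q % 8 = 7) {i : K} (hi : i ^ 2 = -1)
    {c d x y : ℤ} (h : c ^ 2 + d ^ 2 = x ^ 2 + 2 * q * y ^ 2) (hxy : IsCoprime x y)
    (hd : 4 ∣ d) (hx : x % 4 = 1) (hqxd : ¬ (q : ℤ) ∣ x + d) :
    ((c : K) + d * i) ^ ((q + 1) / 2) = x * (ZMod.χ₈ (x + d : ℤ) : ℤ) := by
  have hq2 : q ≠ 2 := by rintro rfl; omega
  have hiq : i ^ q = -i := by
    rw [pow_char_eq_legendreSym_mul_of_sq_eq hq2 (n := -1) (by simpa using hi),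
      legendreSym.at_neg_one hq2, ZMod.χ₄_nat_three_mod_four (by omega)]
    push_cast
    ring
  have hi_half : (-i) ^ ((q + 1) / 2) = 1 := by
    rw [show (q + 1) / 2 = 2 * (2 * ((q + 1) / 8)) by omega, pow_mul, neg_sq, hi, pow_mul,
      neg_one_sq, one_pow]
  have hn : Odd (x + d) := Int.odd_iff.mpr (by omega)
  have hleg : legendreSym q (x + d) = ZMod.χ₈ (x + d : ℤ) :=
    legendreSym_eq_χ₈_of_mul_eq_sq_sub (by omega) (by omega) hqxd
      (show (x + d) * (x - d) = c ^ 2 - 2 * q * y ^ 2 by linear_combination -h)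
      fun l hl => not_dvd_of_mul_add_eq_two_mul hl hn (m := 1) (by ring) hxy
  have hK := congrArg (Int.cast : ℤ → K) h
  push_cast at hK
  rw [CharP.cast_eq_zero] at hK
  rw [← hleg, ← legendreSym_two_mul hq, ← add_pow_half_eq_mul_legendreSym hq2 (w := -(c * i))
    (by rw [neg_pow, mul_pow, intCast_pow_char, hiq, Odd.neg_one_pow (Nat.odd_iff.mpr (by omega))];
        ring)
    (by linear_combination hK - c ^ 2 * hi) hqxd,
    show d + -(c * i) = -i * (c + d * i) by linear_combination d * hi, mul_pow, hi_half, one_mul]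

theorem not_dvd_sub_of_dvd_add (hq : q ≠ 2) {x n : ℤ} (hqx : ¬ (q : ℤ) ∣ x)
    (h : (q : ℤ) ∣ x + n) : ¬ (q : ℤ) ∣ x - n := fun h' => by
  have h2x : (q : ℤ) ∣ 2 * x := by
    rw [show 2 * x = (x + n) + (x - n) by ring]
    exact dvd_add h h'
  rcases (Nat.prime_iff_prime_int.mp Fact.out).dvd_or_dvd h2x with h2 | hx
  · exact hq ((Nat.prime_dvd_prime_iff_eq Fact.out Nat.prime_two).mp (by exact_mod_cast h2))
  · exact hqx hx

theorem add_mul_sqrt_neg_one_pow_half (hq : q % 8 = 7) {i : K} (hi : i ^ 2 = -1)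
    {c d x y : ℤ} (h : c ^ 2 + d ^ 2 = x ^ 2 + 2 * q * y ^ 2) (hxy : IsCoprime x y)
    (hqx : ¬ (q : ℤ) ∣ x) (hd : 4 ∣ d) (hx : x % 4 = 1) :
    ((c : K) + d * i) ^ ((q + 1) / 2) = x * (ZMod.χ₈ (x + d : ℤ) : ℤ) := by
  by_cases hqxd : (q : ℤ) ∣ x + d
  swap
  · exact add_mul_sqrt_neg_one_pow_half_of_not_dvd hq hi h hxy hd hx hqxd
  have hqxd' : ¬ (q : ℤ) ∣ x + -d := not_dvd_sub_of_dvd_add (by rintro rfl; omega) hqx hqxd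
  have hmod : ((x + d : ℤ) : ZMod 8) = (x + -d : ℤ) := by
    rw [ZMod.intCast_eq_intCast_iff, Int.modEq_iff_dvd]
    push_cast
    omega
  rw [hmod, ← add_mul_sqrt_neg_one_pow_half_of_not_dvd hq (i := -i) (by rw [neg_sq, hi])
    (c := c) (by rw [neg_sq, h]) hxy (dvd_neg.mpr hd) hx hqxd', Int.cast_neg, neg_mul_neg]

theorem add_mul_sqrt_neg_two_pow_half (hq : q % 8 = 7) {r : K} (hr : r ^ 2 = -2)
    {A B x y : ℤ} (h : A ^ 2 + 2 * B ^ 2 = x ^ 2 + 2 * q * y ^ 2) (hxy : IsCoprime x y)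
    (hqx : ¬ (q : ℤ) ∣ x) (hx : x % 4 = 1) (hA : A % 4 = 1) :
    ((A : K) + B * r) ^ ((q + 1) / 2) = x * (ZMod.χ₄ ((x + A) / 2 : ℤ) : ℤ) := by
  have hq2 : q ≠ 2 := by rintro rfl; omega
  have hw : ((B : K) * r) ^ q = -(B * r) := by
    rw [mul_pow, intCast_pow_char, pow_char_eq_legendreSym_mul_of_sq_eq hq2 (n := -2)
      (by simpa using hr), legendreSym.at_neg_two hq2, ZMod.χ₈'_nat_eq_if_mod_eight,
      if_neg (by omega), if_neg (by omega)]
    push_cast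
    ring
  obtain ⟨n, hn⟩ : ∃ n, x + A = 2 * n := ⟨(x + A) / 2, by omega⟩
  have hn_odd : Odd n := Int.odd_iff.mpr (by omega)
  have hfactor : n * (x - A) = B ^ 2 - q * y ^ 2 := by
    refine mul_left_cancel₀ (two_ne_zero (α := ℤ)) ?_
    linear_combination (A - x) * hn - h
  have hprim (l : ℤ) (hl : Prime l) : l ∣ n → l ∣ x - A → ¬ l ∣ y :=
    not_dvd_of_mul_add_eq_two_mul hl hn_odd (m := 2) (by omega) hxy
  have hK := congrArg (Int.cast : ℤ → K) h
  push_cast at hK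
  rw [CharP.cast_eq_zero] at hK
  rw [show (x + A) / 2 = n by omega]
  by_cases hqxA : (q : ℤ) ∣ x + A
  · have hqk : ¬ (q : ℤ) ∣ x - A := not_dvd_sub_of_dvd_add hq2 hqx hqxA
    rw [add_pow_half_eq_mul_legendreSym hq2 hw (x := -x)
      (by push_cast; linear_combination hK - B ^ 2 * hr) (by rwa [← dvd_neg, neg_add, neg_neg]),
      legendreSym_two_mul hq, show -x + A = -(x - A) by ring, legendreSym_neg (by omega),
      legendreSym_cofactor_eq_χ₄_of_mul_eq_sq_sub (by omega) hn_odd hqk hfactor hprim]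
    push_cast
    ring
  · have hqn : ¬ (q : ℤ) ∣ n := fun hqn => hqxA (hn ▸ hqn.mul_left 2)
    rw [add_pow_half_eq_mul_legendreSym hq2 hw (by linear_combination hK - B ^ 2 * hr) hqxA, hn,
      legendreSym_two_mul hq, legendreSym_two_mul hq,
      legendreSym_eq_χ₄_of_mul_eq_sq_sub (by omega) hn_odd hqn hfactor hprim]

theorem odd_of_odd_sq_add_two_mul {a k : ℤ} (h : Odd (a ^ 2 + 2 * k)) : Odd a :=
  (Int.odd_pow' two_ne_zero).mp (Int.odd_add.mp h |>.mpr (even_two_mul k))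

theorem mul_pow_half_eq_prime_of_mod_four (hq : q % 8 = 7) {i r : K} (hi : i ^ 2 = -1)
    (hr : r ^ 2 = -2) {P c d x y A B : ℤ} (hP : Prime P) (hP8 : P % 8 = 1) (hqP : ¬ (q : ℤ) ∣ P)
    (hcd : P = c ^ 2 + d ^ 2) (hc : Odd c) (hxy : P = x ^ 2 + 2 * q * y ^ 2) (hx : x % 4 = 1)
    (hAB : P = A ^ 2 + 2 * B ^ 2) (hA : A % 4 = 1) :
    (((A : K) + B * r) * (c + d * i)) ^ ((q + 1) / 2) = P := by
  have hqx : ¬ (q : ℤ) ∣ x := fun hqx => hqP <| by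
    rw [hxy, mul_right_comm]
    exact dvd_add (dvd_pow hqx two_ne_zero) (dvd_mul_left _ _)
  have hxy_coprime := isCoprime_of_prime_eq_sq_add_mul_sq hP hxy
  have hd := four_dvd_of_sq_add_sq_mod_eight hP8 hc hcd
  have χ₈_sq : (ZMod.χ₈ (x + d : ℤ) : K) ^ 2 = 1 := by
    rw [ZMod.χ₈_int_eq_if_mod_eight, if_neg (by omega)]
    split_ifs <;> norm_num
  have hPK : (P : K) = x ^ 2 := by
    rw [hxy]
    push_cast
    rw [CharP.cast_eq_zero]
    ring
  rw [mul_pow, add_mul_sqrt_neg_two_pow_half hq hr (hAB ▸ hxy) hxy_coprime hqx hx hA,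
    add_mul_sqrt_neg_one_pow_half hq hi (hcd ▸ hxy) hxy_coprime hqx hd hx,
    χ₄_half_add_eq_χ₈_add hcd hAB (isCoprime_of_prime_eq_sq_add_mul_sq hP hAB) hd hx hA]
  linear_combination (x : K) ^ 2 * χ₈_sq - hPK

theorem mul_pow_half_eq_prime (hq : q % 8 = 7) {i r : K} (hi : i ^ 2 = -1) (hr : r ^ 2 = -2)
    {P c d x y A B : ℤ} (hP : Prime P) (hP8 : P % 8 = 1) (hqP : ¬ (q : ℤ) ∣ P)
    (hcd : P = c ^ 2 + d ^ 2) (hc : Odd c) (hxy : P = x ^ 2 + 2 * q * y ^ 2)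
    (hAB : P = A ^ 2 + 2 * B ^ 2) :
    (((A : K) + B * r) * (c + d * i)) ^ ((q + 1) / 2) = P := by
  have hP_odd : Odd P := Int.odd_iff.mpr (by omega)
  have hx_odd : Odd x := odd_of_odd_sq_add_two_mul (k := q * y ^ 2) (by rwa [← mul_assoc, ← hxy])
  have hA_odd : Odd A := odd_of_odd_sq_add_two_mul (by rwa [← hAB])
  wlog hx : x % 4 = 1 generalizing x
  · exact this (x := -x) (by rwa [neg_sq]) hx_odd.neg (by grind)
  wlog hA : A % 4 = 1 generalizing A B
  · have h := this (A := -A) (B := -B) (by rwa [neg_sq, neg_sq]) hA_odd.neg (by grind)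
    have hq_even : Even ((q + 1) / 2) := Nat.even_iff.mpr (by omega)
    rwa [Int.cast_neg, Int.cast_neg, neg_mul, ← neg_add, neg_mul, hq_even.neg_pow] at h
  exact mul_pow_half_eq_prime_of_mod_four hq hi hr hP hP8 hqP hcd hc hxy hx hAB hA

end HalfPowers

section OcticReciprocity

open ZetaEight

variable {p e : ℕ} [Fact p.Prime] {c d : ℤ} {w : ZMod p} {hw : w ^ 4 = -1}
  {χ : MulChar (ZMod p) ZetaEight} {K : Type*} [Field K]

theorem exists_gaussSum_pow_eight_eq (he : p = 8 * e + 1) (hcd : (p : ℤ) = c ^ 2 + d ^ 2)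
    (hc : Odd c) (hcdw : (c : ZMod p) + d * w ^ 2 = 0) (hχ : IsOctic χ)
    (hχw : ∀ x, lift w hw (χ x) = x ^ e) (hK : (-1 : K) ≠ 1) {z : K} (hz : z ^ 4 = -1)
    {ψ : AddChar (ZMod p) K} (hψ : ψ.IsPrimitive) :
    ∃ A B : ℤ, (p : ℤ) = A ^ 2 + 2 * B ^ 2 ∧ gaussSum (χ.ringHomComp (lift z hz)) ψ ^ 8 =
      p * (A + B * (z + z ^ 3)) ^ 4 * (c + d * z ^ 2) ^ 2 := by
  have hF : ringChar (ZMod p) ≠ 2 :=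
    ringChar_ne_two_of_odd_card (by rw [ZMod.card, he]; exact ⟨4 * e, by ring⟩)
  obtain ⟨A, B, hAB, hJ⟩ := hχ.exists_jacobiSum_pow_four_eq hF
  rw [ZMod.card] at hAB
  refine ⟨A, B, hAB.symm, ?_⟩
  rw [gaussSum_pow_eight (hχ.ringHomComp _) hF hK hψ, ZMod.card, MulChar.ringHomComp_pow,
    MulChar.ringHomComp_pow, jacobiSum_ringHomComp, jacobiSum_ringHomComp, hJ, ← map_pow _ _ 2,
    jacobiSum_sq_pow_four_sq_eq he hcd.symm hc hcdw hχ hχw]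
  simp

theorem lift_apply_neg_eq_div_pow {q : ℕ} [Fact q.Prime] [CharP K q] (he : p = 8 * e + 1)
    (hq : q % 8 = 7) {x y : ℤ} (hcd : (p : ℤ) = c ^ 2 + d ^ 2) (hc : Odd c)
    (hxy : (p : ℤ) = x ^ 2 + 2 * q * y ^ 2) (hcdw : (c : ZMod p) + d * w ^ 2 = 0) (hχ : IsOctic χ)
    (hχw : ∀ x, lift w hw (χ x) = x ^ e) {ξ : K} (hξ : IsPrimitiveRoot ξ p) {z : K}
    (hz : z ^ 4 = -1) :
    lift z hz (χ (-q)) = ((c - d * z ^ 2) / (c + d * z ^ 2)) ^ ((q + 1) / 8) := by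
  have : NeZero p := ⟨(Fact.out : p.Prime).ne_zero⟩
  have hqp : ¬ q ∣ p := fun h => by
    have := (Nat.prime_dvd_prime_iff_eq Fact.out Fact.out).mp h
    omega
  have hq_unit : IsUnit (q : ZMod p) := (ZMod.isUnit_iff_coprime q p).mpr
    ((Nat.Prime.coprime_iff_not_dvd Fact.out).mpr hqp)
  have hF : ringChar (ZMod p) ≠ 2 :=
    ringChar_ne_two_of_odd_card (by rw [ZMod.card, he]; exact ⟨4 * e, by ring⟩)
  have hK : (-1 : K) ≠ 1 := Ring.neg_one_ne_one_of_char_ne_two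
    (by rw [ringChar.eq K q]; rintro rfl; omega)
  have hψ := AddChar.zmodChar_primitive_of_primitive_root p hξ
  have frobenius := apply_neg_mul_card_eq_gaussSum_pow_eight_pow hq hq_unit hF
    (hχ.ringHomComp (lift z hz)) hψ
  obtain ⟨A, B, hAB, pow_eight⟩ := exists_gaussSum_pow_eight_eq he hcd hc hcdw hχ hχw hK hz hψ
  have half_power := mul_pow_half_eq_prime (K := K) hq (i := z ^ 2) (r := z + z ^ 3)
    (by rw [← pow_mul, hz]) (by linear_combination (z ^ 2 + 2) * hz)
    (Nat.prime_iff_prime_int.mp Fact.out) (by omega) (mod_cast hqp) hcd hc hxy hAB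
  rw [pow_eight, ZMod.card, MulChar.ringHomComp_apply] at frobenius
  rw [show (q + 1) / 2 = 4 * ((q + 1) / 8) by omega, mul_pow, pow_mul, pow_mul] at half_power
  generalize (q + 1) / 8 = N at *
  set ρ : K := A + B * (z + z ^ 3)
  set π : K := c + d * z ^ 2 with hπ
  set π' : K := c - d * z ^ 2 with hπ'
  have norm_π : (p : K) = π * π' := by
    have := congrArg (Int.cast : ℤ → K) hcd
    push_cast at this
    rw [this, hπ, hπ']
    linear_combination (d : K) ^ 2 * hz
  have hpK : (p : K) ≠ 0 := by rwa [Ne, CharP.cast_eq_zero_iff K q]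
  have hπN : π ^ N ≠ 0 := pow_ne_zero N (left_ne_zero_of_mul (norm_π ▸ hpK))
  rw [div_pow, eq_div_iff hπN]
  refine mul_left_cancel₀ hpK ?_
  calc (p : K) * (lift z hz (χ (-q)) * π ^ N) = lift z hz (χ (-q)) * p * π ^ N := by ring
    _ = (p * ρ ^ 4 * π ^ 2) ^ N * π ^ N := by rw [frobenius]
    _ = ((ρ ^ 4) ^ N * (π ^ 4) ^ N) * π' ^ N := by
      rw [← mul_pow, ← mul_pow, ← mul_pow, norm_π]
      ring
    _ = p * π' ^ N := by rw [half_power, Int.cast_natCast]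

end OcticReciprocity

section FourthRootsOfUnity

variable {F : Type*} [Field F] {i : F}

theorem zpow_eq_zpow_iff_of_sq_eq_neg_one (hF : (-1 : F) ≠ 1) (hi : i ^ 2 = -1) (m n : ℤ) :
    i ^ m = i ^ n ↔ (4 : ℤ) ∣ m - n := by
  have hi0 : i ≠ 0 := by rintro rfl; norm_num at hi
  have hord : orderOf i = 2 ^ (1 + 1) :=
    orderOf_eq_prime_pow (by rwa [pow_one, hi]) (by linear_combination (i ^ 2 - 1) * hi)
  have hprim : IsPrimitiveRoot i 4 := IsPrimitiveRoot.iff_orderOf.mpr hord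
  rw [← Nat.cast_ofNat (n := 4), ← hprim.zpow_eq_one_iff_dvd, zpow_sub₀ hi0,
    div_eq_one_iff_eq (zpow_ne_zero _ hi0)]

theorem zpow_eq_pow_toNat_emod_four (hi : i ^ 2 = -1) (m : ℤ) : i ^ m = i ^ (m % 4).toNat := by
  have hi0 : i ≠ 0 := by rintro rfl; norm_num at hi
  have h4 : i ^ (4 : ℤ) = 1 := mod_cast (by linear_combination (i ^ 2 - 1) * hi : i ^ 4 = 1)
  rw [← zpow_natCast, Int.toNat_of_nonneg (by omega)]
  conv_lhs => rw [← Int.mul_ediv_add_emod m 4]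
  rw [zpow_add₀ hi0, zpow_mul, h4, one_zpow, one_mul]

end FourthRootsOfUnity

section GaussianCongruence

open GaussianInt (toComplex)

theorem gaussModEq_div_iff_dvd {n : ℕ} {u v t : GaussianInt} (ht : IsCoprime t n) (ht0 : t ≠ 0) :
    GaussModEq n (toComplex u / toComplex t) (toComplex v) ↔ (n : GaussianInt) ∣ u - v * t := by
  have htc : toComplex t ≠ 0 := by rwa [Ne, GaussianInt.toComplex_eq_zero]
  have sub_eq : toComplex u / toComplex t - toComplex v = toComplex (u - v * t) / toComplex t := by
    rw [map_sub, map_mul]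
    field_simp
  rw [GaussModEq, sub_eq]
  refine ⟨?_, fun ⟨s, hs⟩ => ⟨s, t, ht, by rw [hs, map_mul, map_natCast, mul_div_assoc]⟩⟩
  rintro ⟨s, t', ht', h⟩
  obtain rfl | ht'0 := eq_or_ne t' 0
  · exact (isCoprime_zero_left.mp ht').dvd
  have ht'c : toComplex t' ≠ 0 := by rwa [Ne, GaussianInt.toComplex_eq_zero]
  refine ht'.symm.dvd_of_dvd_mul_right ⟨s * t, GaussianInt.toComplex_injective ?_⟩
  rw [map_mul, map_mul, map_mul, map_natCast]
  field_simp at h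
  linear_combination h

variable {q : ℕ} [Fact q.Prime] {K : Type*} [Field K] [CharP K q]

theorem map_eq_zero_iff_natCast_dvd_of_mod_four_eq_three (hq : q % 4 = 3) (f : GaussianInt →+* K)
    (s : GaussianInt) : f s = 0 ↔ (q : GaussianInt) ∣ s := by
  refine ⟨fun hs => ?_, ?_⟩
  · have hn : f ((s.norm : ℤ) : GaussianInt) = 0 := by
      rw [Zsqrtd.norm_eq_mul_conj, map_mul, hs, zero_mul]
    rw [map_intCast, CharP.intCast_eq_zero_iff K q, Zsqrtd.norm_def,
      ← ZMod.intCast_zmod_eq_zero_iff_dvd] at hn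
    push_cast at hn
    have him : (s.im : ZMod q) = 0 := by
      by_contra h
      exact ZMod.mod_four_ne_three_of_sq_eq_neg_sq' h (x := s.re) (by linear_combination hn) hq
    have hre : (s.re : ZMod q) = 0 := by simpa [him] using hn
    rw [ZMod.intCast_zmod_eq_zero_iff_dvd] at hre him
    exact mod_cast (Zsqrtd.intCast_dvd (d := -1) (q : ℤ) s).mpr ⟨hre, him⟩
  · rintro ⟨t, rfl⟩
    rw [map_mul, map_natCast, CharP.cast_eq_zero, zero_mul]

theorem isCoprime_natCast_of_not_dvd_norm {s : GaussianInt} (hs : ¬ (q : ℤ) ∣ s.norm) :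
    IsCoprime s (q : GaussianInt) := by
  have hcop : IsCoprime s.norm (q : ℤ) :=
    ((Nat.prime_iff_prime_int.mp Fact.out).coprime_iff_not_dvd.mpr hs).symm
  have h := hcop.map (Int.castRingHom GaussianInt)
  rw [eq_intCast, eq_intCast, Zsqrtd.norm_eq_mul_conj, Int.cast_natCast] at h
  exact h.of_mul_left_left

theorem gaussModEq_div_pow_iff (hq : q % 4 = 3) {c d : ℤ} (hcd : ¬ (q : ℤ) ∣ c ^ 2 + d ^ 2)
    {i : K} (hi : i ^ 2 = -1) (N : ℕ) (m : ℤ) :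
    GaussModEq q (((c - d * Complex.I) / (c + d * Complex.I)) ^ N) (Complex.I ^ m) ↔
      ((c - d * i) / (c + d * i)) ^ N = i ^ m := by
  let α : GaussianInt := ⟨c, d⟩
  have hα : ¬ (q : ℤ) ∣ α.norm := by
    rwa [Zsqrtd.norm_def, show c * c - -1 * d * d = c ^ 2 + d ^ 2 by ring]
  have hα0 : α ≠ 0 := fun h => hα (by rw [h, Zsqrtd.norm_zero]; exact dvd_zero _)
  have hαq : IsCoprime (α ^ N) (q : GaussianInt) := (isCoprime_natCast_of_not_dvd_norm hα).pow_left
  let f : GaussianInt →+* K := Zsqrtd.lift ⟨i, by push_cast; rw [← sq, hi]⟩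
  have hf (a b : ℤ) : f ⟨a, b⟩ = a + b * i := rfl
  have hfα : f α = c + d * i := hf c d
  have hfα' : f (star α) = c - d * i := by
    rw [Zsqrtd.star_mk, hf, Int.cast_neg, neg_mul, ← sub_eq_add_neg]
  have hfi : f ⟨0, 1⟩ = i := by rw [hf, Int.cast_zero, Int.cast_one, zero_add, one_mul]
  rw [zpow_eq_pow_toNat_emod_four hi, zpow_eq_pow_toNat_emod_four Complex.I_sq]
  generalize (m % 4).toNat = k
  have hz : ((c - d * Complex.I) / (c + d * Complex.I)) ^ N =
      toComplex (star α ^ N) / toComplex (α ^ N) := by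
    rw [map_pow, map_pow, ← div_pow]
    simp [α, GaussianInt.toComplex_def, sub_eq_add_neg]
  have hI : Complex.I ^ k = toComplex (⟨0, 1⟩ ^ k) := by
    rw [map_pow]
    simp [GaussianInt.toComplex_def]
  have hα_K : c + d * i ≠ 0 := by
    rw [← hfα, Ne, map_eq_zero_iff_natCast_dvd_of_mod_four_eq_three hq]
    rintro ⟨t, ht⟩
    exact hα ⟨q * t.norm, by rw [ht, Zsqrtd.norm_mul, Zsqrtd.norm_natCast]; ring⟩
  rw [hz, hI, div_pow (c - d * i), div_eq_iff (pow_ne_zero N hα_K),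
    gaussModEq_div_iff_dvd hαq (pow_ne_zero N hα0),
    ← map_eq_zero_iff_natCast_dvd_of_mod_four_eq_three hq f, map_sub, sub_eq_zero, map_mul,
    map_pow, map_pow, map_pow, hfα, hfα', hfi]

end GaussianCongruence

section ResidueClasses

open ZetaEight

variable {p : ℕ} [Fact p.Prime]

theorem div_sq_eq_neg_one_of_eq_sq_add_sq {c d : ℤ} (hcd : (p : ℤ) = c ^ 2 + d ^ 2) :
    ((d : ZMod p) / c) ^ 2 = -1 := by
  have hcast : (c : ZMod p) ^ 2 + (d : ZMod p) ^ 2 = 0 := by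
    have := congrArg (Int.cast : ℤ → ZMod p) hcd
    push_cast at this
    rw [← this, ZMod.natCast_self]
  have hc0 : (c : ZMod p) ≠ 0 := by
    intro hc
    have hd : (d : ZMod p) = 0 := by simpa [hc] using hcast
    rw [ZMod.intCast_zmod_eq_zero_iff_dvd] at hc hd
    have hp : Prime (p : ℤ) := Nat.prime_iff_prime_int.mp Fact.out
    exact hp.not_isUnit ((isCoprime_of_prime_eq_sq_add_mul_sq hp (k := 1)
      (by rw [hcd, one_mul])).isUnit_of_dvd' hc hd)
  field_simp
  linear_combination hcast

theorem isSquare_of_sq_eq_neg_one (hp : p % 8 = 1) {i : ZMod p} (hi : i ^ 2 = -1) :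
    IsSquare i := by
  have hi0 : i ≠ 0 := by rintro rfl; norm_num at hi
  rw [ZMod.euler_criterion p hi0, show p / 2 = 2 * 2 * (p / 8) by omega, pow_mul, pow_mul, hi,
    neg_one_sq, one_pow]

theorem exists_sq_eq_div_of_eq_sq_add_sq (hp : p % 8 = 1) {c d : ℤ}
    (hcd : (p : ℤ) = c ^ 2 + d ^ 2) :
    ∃ w : ZMod p, w ^ 4 = -1 ∧ w ^ 2 = d / c ∧ (c : ZMod p) + d * w ^ 2 = 0 := by
  have hdc := div_sq_eq_neg_one_of_eq_sq_add_sq hcd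
  have hc : (c : ZMod p) ≠ 0 := by
    intro hc
    simp [hc] at hdc
  obtain ⟨w, hw⟩ := isSquare_of_sq_eq_neg_one hp hdc
  rw [← sq] at hw
  refine ⟨w, by rw [← hdc, hw, ← pow_mul], hw.symm, ?_⟩
  rw [← hw]
  field_simp at hdc ⊢
  linear_combination hdc

theorem isSquare_neg_natCast_of_eq_sq_add {q : ℕ} [Fact q.Prime] (hp : p % 4 = 1) (hq : q ≠ 2)
    {x k : ℤ} (hx : (p : ℤ) = x ^ 2 + q * k) : IsSquare (-q : ZMod p) := by
  have hpq : IsSquare (p : ZMod q) := by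
    refine ⟨x, ?_⟩
    have := congrArg (Int.cast : ℤ → ZMod q) hx
    push_cast at this
    rw [this, ZMod.natCast_self, zero_mul, add_zero, sq]
  have hqp := (ZMod.exists_sq_eq_prime_iff_of_mod_four_eq_one hp hq).mpr hpq
  have hneg := ZMod.exists_sq_eq_neg_one_iff.mpr (show p % 4 ≠ 3 by omega)
  rw [← neg_one_mul]
  exact hneg.mul hqp

theorem pow_eq_zpow_iff_lift_apply_eq_zpow {F K : Type*} [Field F] [Finite F] [Field K] {e : ℕ}
    {w : F} {hw : w ^ 4 = -1} {z : K} {hz : z ^ 4 = -1} {χ : MulChar F ZetaEight}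
    (hF : (-1 : F) ≠ 1) (hK : (-1 : K) ≠ 1) (hχ8 : χ ^ 8 = 1)
    (hχ : ∀ x, lift w hw (χ x) = x ^ e) {a : F} (ha : IsSquare a) (ha0 : a ≠ 0) (m : ℤ) :
    a ^ e = (w ^ 2) ^ m ↔ lift z hz (χ a) = (z ^ 2) ^ m := by
  obtain ⟨t, ht⟩ : ∃ t : ℕ, χ a = (ζ ^ 2) ^ t := by
    obtain ⟨b, rfl⟩ := ha
    obtain ⟨t, -, ht⟩ := MulChar.exists_apply_eq_pow hχ8
      (isPrimitiveRoot_eight_of_pow_four_eq_neg_one (by norm_num) ζ_pow_four)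
      (left_ne_zero_of_mul ha0)
    exact ⟨t, by rw [map_mul, ht, ← sq, pow_right_comm]⟩
  rw [← hχ, ht, map_pow, map_pow, map_pow, map_pow, lift_ζ, lift_ζ,
    ← zpow_natCast (w ^ 2), ← zpow_natCast (z ^ 2),
    zpow_eq_zpow_iff_of_sq_eq_neg_one hF ((pow_mul w 2 2).symm.trans hw),
    zpow_eq_zpow_iff_of_sq_eq_neg_one hK ((pow_mul z 2 2).symm.trans hz)]

end ResidueClasses

section Main

open ZetaEight

theorem theorem4p4_general (p q : ℕ) [Fact p.Prime] [Fact q.Prime]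
    (hp : p % 8 = 1) (hq : q % 8 = 7) (c d x y : ℤ)
    (hcd : (p : ℤ) = c ^ 2 + d ^ 2) (hxy : (p : ℤ) = x ^ 2 + 2 * (q : ℤ) * y ^ 2)
    (hc : Odd c) (m : ℤ) :
    (-(q : ZMod p)) ^ ((p - 1) / 8) = ((d : ZMod p) / (c : ZMod p)) ^ m ↔
      GaussModEq q
        ((((c : ℂ) - (d : ℂ) * Complex.I) / ((c : ℂ) + (d : ℂ) * Complex.I)) ^ ((q + 1) / 8))
        (Complex.I ^ m) := by
  have he : p = 8 * ((p - 1) / 8) + 1 := by omega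
  have hqp : ¬ q ∣ p := fun h => by
    have := (Nat.prime_dvd_prime_iff_eq Fact.out Fact.out).mp h
    omega
  have hF : (-1 : ZMod p) ≠ 1 := Ring.neg_one_ne_one_of_char_ne_two
    (by rw [ZMod.ringChar_zmod_n]; omega)
  obtain ⟨w, hw, hwdc, hcdw⟩ := exists_sq_eq_div_of_eq_sq_add_sq hp hcd
  obtain ⟨χ, hχ8, hχ⟩ := exists_lift_apply_eq_pow (by rwa [ZMod.card]) hw
  have hχ_octic : IsOctic χ := isOctic_of_lift_apply_eq_pow (by rwa [ZMod.card]) hχ8 hχ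
  let K := AlgebraicClosure (ZMod q)
  have : CharP K q := charP_of_injective_algebraMap (algebraMap (ZMod q) K).injective q
  have hK : (-1 : K) ≠ 1 := Ring.neg_one_ne_one_of_char_ne_two (by rw [ringChar.eq K q]; omega)
  have : NeZero (p : K) := ⟨by rwa [Ne, CharP.cast_eq_zero_iff K q]⟩
  obtain ⟨ξ, hξ⟩ := HasEnoughRootsOfUnity.exists_primitiveRoot K p
  obtain ⟨z, hz⟩ := IsAlgClosed.exists_pow_nat_eq (-1 : K) (n := 4) (by norm_num)
  rw [← hwdc, pow_eq_zpow_iff_lift_apply_eq_zpow (hz := hz) hF hK hχ8 hχ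
      (isSquare_neg_natCast_of_eq_sq_add (k := 2 * y ^ 2) (by omega) (by omega)
        (by rw [hxy]; ring))
      (neg_ne_zero.mpr (ZMod.prime_ne_zero p q (by omega))),
    gaussModEq_div_pow_iff (by omega) (by rw [← hcd]; exact_mod_cast hqp)
      ((pow_mul z 2 2).symm.trans hz),
    lift_apply_neg_eq_div_pow he hq hcd hc hxy hcdw hχ_octic hχ hξ hz]

end Main

theorem theorem4p4 (p q : ℕ) [Fact p.Prime] [Fact q.Prime]
    (hp : p % 8 = 1) (hq : q % 8 = 7)
    (c d x y d₀ : ℤ) (r : ℕ)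
    (hcd : (p : ℤ) = c ^ 2 + d ^ 2)
    (hxy : (p : ℤ) = x ^ 2 + 2 * (q : ℤ) * y ^ 2)
    (hc : c ≡ 1 [ZMOD 4])
    (hd : d = 2 ^ r * d₀)
    (hd₀ : d₀ ≡ 1 [ZMOD 4])
    (hcop : Int.gcd c (x + d) = 1 ∨ Int.gcd d₀ (x + c) = 1)
    (m : ℤ) :
    (-(q : ZMod p)) ^ ((p - 1) / 8) = ((d : ZMod p) / (c : ZMod p)) ^ m ↔
      GaussModEq q
        ((((c : ℂ) - (d : ℂ) * Complex.I) / ((c : ℂ) + (d : ℂ) * Complex.I)) ^ ((q + 1) / 8))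
        (Complex.I ^ m) := by
  have hc' : Odd c := Int.odd_iff.mpr (hc.of_dvd (show (2 : ℤ) ∣ 4 by norm_num))
  exact theorem4p4_general p q hp hq c d x y hcd hxy hc' m
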